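/- Let $M$ be a monoid. An $M$-set is a set with a left action of $M$; it is projective if every $M$-equivariant surjection onto it has an $M$-equivariant section, and finitely generated if it is a finite union of orbits $Ms$. A projective $M$-CW complex is a left $M$-space $X$ (with $M$ discrete) that is the colimit of $M$-spaces $X_0\to X_1\to X_2\to\cdots$, where $X_0=P_0$ is a discrete projective $M$-set and, for each $n\ge 1$, $X_n$ is a pushout, in the category of $M$-spaces, of $X_{n-1}\leftarrow P_n\times S^{n-1}\hookrightarrow P_n\times B^n$ with $P_n$ a projective $M$-set and $B^n$ carrying the trivial action. Say that $M$ is of type left-$\mathrm{F}_n$ if there is a contractible projective $M$-CW complex whose $n$-skeleton is $M$-finite, i.e. $P_k$ is a finitely generated $M$-set for all $k\le n$; and that $M$ is of type left-$\mathrm{FP}_n$ if the trivial left $\mathbb{Z}M$-module $\mathbb{Z}$ has a projective resolution whose terms in degrees $\le n$ are finitely generated. For $A\subseteq M$ let $\Gamma(M,A)$ be the right Cayley digraph, with vertex set $M$ and, for each $(m,a)\in M\times A$, one arc from $m$ to $ma$. The following are equivalent: (1) $M$ is of type left-$\mathrm{F}_1$; (2) $M$ is of type left-$\mathrm{FP}_1$;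 (3) there is a finite subset $A\subseteq M$ such that $\Gamma(M,A)$ is connected as an undirected graph. In particular, every finitely generated monoid is of type left-$\mathrm{F}_1$. -/

import Mathlib

open CategoryTheory CategoryTheory.Limits

universe u

namespace MonoidFiniteness

/-! ## Monoid acts (`M`-sets) -/

/-- An `M`-set `P` is projective if every `M`-equivariant surjection onto `P` has an
`M`-equivariant section. -/
def IsProjectiveAct (M : Type u) [Monoid M] (P : Type u) [MulAction M P] : Prop :=
  ∀ (X : Type u) [MulAction M X] (f : X →[M] P), Function.Surjective f →
    ∃ s : P →[M] X, ∀ p : P, f (s p) = p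

/-- An `M`-set `P` is finitely generated if it is the union of finitely many orbits `M s`. -/
def IsFinitelyGeneratedAct (M : Type u) [Monoid M] (P : Type u) [MulAction M P] : Prop :=
  ∃ S : Finset P, ∀ p : P, ∃ s ∈ S, ∃ m : M, m • s = p

/-! ## `M`-spaces

The category of left `M`-spaces (`M` discrete) is `Action TopCat M`: an object is a topological
space together with a monoid homomorphism from `M` to its continuous self-maps. -/

section MSpaces

variable (M : Type u) [Monoid M] (P : Type u) [MulAction M P]
  [TopologicalSpace P] [DiscreteTopology P]

/-- The `M`-set `P` as a discrete `M`-space. -/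
def discreteSpace : Action TopCat.{u} M where
  V := TopCat.of P
  ρ :=
    { toFun := fun m => TopCat.ofHom ⟨fun p : P => m • p, continuous_of_discreteTopology⟩
      map_one' := TopCat.hom_ext (ContinuousMap.ext fun p => one_smul M p)
      map_mul' := fun m n => TopCat.hom_ext (ContinuousMap.ext fun p => mul_smul m n p) }

/-- The `M`-space `P × K`, where `P` is a discrete `M`-set and `M` acts trivially on `K`. -/
def prodTrivial (K : TopCat.{u}) : Action TopCat.{u} M where
  V := TopCat.of (P × K)
  ρ :=
    { toFun := fun m => TopCat.ofHom ⟨fun x : P × K => (m • x.1, x.2),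
        (continuous_of_discreteTopology.comp continuous_fst).prodMk continuous_snd⟩
      map_one' := TopCat.hom_ext (ContinuousMap.ext fun x => Prod.ext (one_smul M x.1) rfl)
      map_mul' := fun m n => TopCat.hom_ext (ContinuousMap.ext fun x => Prod.ext (mul_smul m n x.1) rfl) }

/-- The `M`-equivariant map `P × K → P × L` induced by a continuous map `K → L`. -/
def prodTrivialMap {K L : TopCat.{u}} (f : K ⟶ L) : prodTrivial M P K ⟶ prodTrivial M P L where
  hom := TopCat.ofHom ⟨fun x : P × K => (x.1, f x.2),
    continuous_fst.prodMk (f.hom.continuous.comp continuous_snd)⟩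
  comm _ := rfl

end MSpaces

/-! ## Projective `M`-CW complexes -/

/-- A projective (left) `M`-CW complex: a colimit of `M`-spaces `X₀ → X₁ → X₂ → ⋯`, where
`X₀ = P₀` is a discrete projective `M`-set and, for every `n`, the space `Xₙ₊₁` is a pushout of
`Xₙ ← Pₙ₊₁ × Sⁿ ↪ Pₙ₊₁ × Bⁿ⁺¹` in the category of `M`-spaces, with `Pₙ₊₁` a projective `M`-set
and `M` acting trivially on the ball `Bⁿ⁺¹` and on its boundary `Sⁿ`. -/
structure ProjectiveCWComplex (M : Type u) [Monoid M] where
  /-- the `n`-skeleton `Xₙ` -/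
  skeleton : ℕ → Action TopCat.{u} M
  /-- the map `Xₙ → Xₙ₊₁` -/
  incl : ∀ n, skeleton n ⟶ skeleton (n + 1)
  /-- the `M`-set `Pₙ` of `n`-cells -/
  cells : ℕ → Type u
  [mulAction : ∀ n, MulAction M (cells n)]
  [topologicalSpace : ∀ n, TopologicalSpace (cells n)]
  [discreteTopology : ∀ n, DiscreteTopology (cells n)]
  projective : ∀ n, IsProjectiveAct M (cells n)
  /-- `X₀` is the discrete `M`-space `P₀` -/
  zeroIso : discreteSpace M (cells 0) ≅ skeleton 0
  /-- the attaching map of the `(n + 1)`-cells -/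
  attach : ∀ n, prodTrivial M (cells (n + 1)) (TopCat.diskBoundary.{u} (n + 1)) ⟶ skeleton n
  /-- the characteristic map of the `(n + 1)`-cells -/
  char : ∀ n, prodTrivial M (cells (n + 1)) (TopCat.disk.{u} (n + 1)) ⟶ skeleton (n + 1)
  isPushout : ∀ n, IsPushout (attach n)
    (prodTrivialMap M (cells (n + 1)) (TopCat.diskBoundaryInclusion.{u} (n + 1)))
    (incl n) (char n)
  /-- the `M`-space `X`, with the maps `Xₙ → X` -/
  cocone : Cocone (Functor.ofSequence incl)
  /-- `X` is the colimit of its skeleta -/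
  isColimit : IsColimit cocone

attribute [instance] ProjectiveCWComplex.mulAction ProjectiveCWComplex.topologicalSpace
  ProjectiveCWComplex.discreteTopology

namespace ProjectiveCWComplex

variable {M : Type u} [Monoid M] (X : ProjectiveCWComplex M)

/-- The topological space underlying a projective `M`-CW complex. -/
def space : TopCat.{u} := X.cocone.pt.V

/-- The `n`-skeleton of `X` is `M`-finite: it is built from finitely many `M`-cells, i.e. the
`M`-sets of `k`-cells with `k ≤ n` are finitely generated. -/
def SkeletonIsFinite (n : ℕ) : Prop :=
  ∀ k ≤ n, IsFinitelyGeneratedAct M (X.cells k)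

/-- `X` is a left equivariant classifying space for `M` if it is contractible. -/
def IsEquivariantClassifyingSpace : Prop :=
  ContractibleSpace X.space

end ProjectiveCWComplex

/-- `M` is of type left-`F_n`: there is a left equivariant classifying space for `M` whose
`n`-skeleton is `M`-finite. -/
def IsLeftF (n : ℕ) (M : Type u) [Monoid M] : Prop :=
  ∃ X : ProjectiveCWComplex M, X.IsEquivariantClassifyingSpace ∧ X.SkeletonIsFinite n

/-! ## The homological finiteness property -/

/-- The trivial left `ℤM`-module `ℤ` (each `m : M` acts as the identity), in the universe of
`M`. -/
noncomputable def trivialModule (M : Type u) [Monoid M] : ModuleCat.{u} (MonoidAlgebra ℤ M) :=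
  ModuleCat.of (MonoidAlgebra ℤ M) (ULift.{u} (Representation.trivial ℤ M ℤ).asModule)

/-- `M` is of type left-`FP_n`: the trivial left `ℤM`-module `ℤ` has a projective resolution
`P` with `P_k` finitely generated for all `k ≤ n`. -/
def IsLeftFP (n : ℕ) (M : Type u) [Monoid M] : Prop :=
  ∃ P : ProjectiveResolution (trivialModule M),
    ∀ k ≤ n, Module.Finite (MonoidAlgebra ℤ M) (P.complex.X k)

/-! ## The right Cayley digraph -/

/-- The vertex set `M` of the right Cayley digraph `Γ(M, A)`. -/
structure CayleyDigraph {M : Type u} [Monoid M] (A : Set M) where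
  /-- the element of `M` corresponding to the vertex -/
  val : M

/-- The arcs of `Γ(M, A)` are in bijection with `M × A`: the arc `(m, a)` goes from `m` to
`m * a`. -/
instance cayleyQuiver {M : Type u} [Monoid M] (A : Set M) : Quiver (CayleyDigraph A) where
  Hom x y := {a : A // x.val * (a : M) = y.val}

/-- A (nonempty) digraph is connected as an undirected graph if any two vertices are joined by a
path that may traverse arcs in both directions. -/
def IsConnectedUndirected (V : Type u) [Quiver V] : Prop :=
  Nonempty V ∧ Quiver.IsStronglyConnected (Quiver.Symmetrify V)

end MonoidFiniteness

/-! Everything is compared with condition (3).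

(2) ⇔ (3): let `I` be the kernel of the augmentation `ℤM → ℤ`. Type left-`FP₁` means that `ℤ` is
finitely presented, i.e. that `I` is a finitely generated left ideal. Since `m(a - 1) = ma - m` is
the difference of the ends of an arc, the left ideal generated by the `a - 1`, `a ∈ A`, is spanned
by the differences of vertices in one component of `Γ(M, A)`; it equals `I` exactly when the graph
is connected (`fg_ker_augmentation_iff`).

(1) ⇒ (3): cells of dimension at least 2 have connected boundary, so a connected complex has a
connected 1-skeleton (`eqvGen_vertexAdj`). A projective `M`-set maps equivariantly to `M`; under
such a map of the vertices, the finitely many ends of generating 1-cells, together with the image of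
one vertex, form a suitable `A`.

(3) ⇒ (1): the Cayley graph is the 1-skeleton of a free `M`-CW complex. Attach free cells along all
maps of spheres in each higher dimension; only dimensions 0 and 1 must be `M`-finite. A contraction
is built skeleton by skeleton, moving `Xₙ` inside `Xₙ₊₁` (`Contraction.exists_succ`), and passes to
the colimit. -/

namespace MonoidFiniteness

/-! ## Connectivity of the right Cayley digraph -/

section Cayley

variable {M : Type u} [Monoid M]

/-- Adjacency in the right Cayley digraph. -/
def CayleyAdj (A : Set M) (x y : M) : Prop := ∃ a ∈ A, x * a = y

/-- Undirected paths are zigzags of arcs. The form with `EqvGen` allows induction on zigzags and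
needs only the base vertex 1. -/
theorem isConnectedUndirected_cayleyDigraph_iff (A : Set M) :
    IsConnectedUndirected (CayleyDigraph A) ↔ ∀ m : M, Relation.EqvGen (CayleyAdj A) 1 m := by
  constructor
  · rintro ⟨-, h⟩ m
    obtain ⟨p⟩ := h (⟨1⟩ : CayleyDigraph A) (⟨m⟩ : CayleyDigraph A)
    suffices H : ∀ (x y : Quiver.Symmetrify (CayleyDigraph A)) (_ : Quiver.Path x y),
        Relation.EqvGen (CayleyAdj A) (CayleyDigraph.val x) (CayleyDigraph.val y) from H _ _ p
    intro x y p
    induction p with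
    | nil => exact .refl _
    | cons _ e ih =>
      refine ih.trans _ _ _ ?_
      rcases e with e | e
      · exact .rel _ _ ⟨e.1, e.1.2, e.2⟩
      · exact .symm _ _ (.rel _ _ ⟨e.1, e.1.2, e.2⟩)
  · intro h
    refine ⟨⟨⟨1⟩⟩, ?_⟩
    have key : ∀ x y : M, Relation.EqvGen (CayleyAdj A) x y →
        (Quiver.zigzagSetoid (CayleyDigraph A)).r ⟨x⟩ ⟨y⟩ := by
      intro x y hxy
      induction hxy with
      | rel x y h =>
        obtain ⟨a, ha, hxy⟩ := h
        exact ⟨Quiver.Hom.toPath (V := Quiver.Symmetrify (CayleyDigraph A))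
          (Sum.inl ⟨⟨a, ha⟩, hxy⟩)⟩
      | refl x => exact Setoid.refl' _ _
      | symm x y _ ih => exact Setoid.symm' _ ih
      | trans x y z _ _ ih₁ ih₂ => exact Setoid.trans' _ ih₁ ih₂
    rintro ⟨x⟩ ⟨y⟩
    exact key x y ((h x).symm.trans _ _ _ (h y))

theorem isConnectedUndirected_cayleyDigraph_of_closure_eq_top {A : Set M}
    (hA : Submonoid.closure A = ⊤) : IsConnectedUndirected (CayleyDigraph A) := by
  rw [isConnectedUndirected_cayleyDigraph_iff]
  intro m
  have hm : m ∈ Submonoid.closure A := hA ▸ Submonoid.mem_top m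
  induction hm using Submonoid.closure_induction_right with
  | one => exact .refl _
  | mul_right x _ a ha ih => exact ih.trans _ _ _ (.rel _ _ ⟨a, ha, rfl⟩)

end Cayley

/-! ## The augmentation ideal -/

section Augmentation

/-- The augmentation `ℤM → ℤ` onto the trivial module. -/
noncomputable def augmentation (M : Type u) [Monoid M] :
    MonoidAlgebra ℤ M →ₗ[MonoidAlgebra ℤ M] trivialModule M :=
  LinearMap.toSpanSingleton (MonoidAlgebra ℤ M) (trivialModule M)
    (ULift.up ((Representation.trivial ℤ M ℤ).asModuleEquiv.symm 1))

variable {M : Type u} [Monoid M]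

/-- The additive identification of the trivial module with `ℤ`. -/
noncomputable def trivialModuleEquivInt (M : Type u) [Monoid M] : trivialModule M ≃+ ℤ :=
  AddEquiv.ulift.trans (Representation.trivial ℤ M ℤ).asModuleEquiv.toAddEquiv

theorem trivialModuleEquivInt_augmentation_single (m : M) (n : ℤ) :
    trivialModuleEquivInt M (augmentation M (MonoidAlgebra.single m n)) = n := by
  change (Representation.trivial ℤ M ℤ).asModuleEquiv
    (MonoidAlgebra.single m n • (Representation.trivial ℤ M ℤ).asModuleEquiv.symm 1) = n
  rw [Representation.asModuleEquiv_map_smul, Representation.asAlgebraHom_single]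
  simp

theorem augmentation_surjective : Function.Surjective (augmentation M) := fun t =>
  ⟨MonoidAlgebra.single 1 (trivialModuleEquivInt M t),
    (trivialModuleEquivInt M).injective (trivialModuleEquivInt_augmentation_single _ _)⟩

theorem single_sub_one_mem_ker_augmentation (m : M) :
    MonoidAlgebra.single m (1 : ℤ) - 1 ∈ LinearMap.ker (augmentation M) := by
  rw [LinearMap.mem_ker, map_sub, sub_eq_zero, MonoidAlgebra.one_def]
  apply (trivialModuleEquivInt M).injective
  simp only [trivialModuleEquivInt_augmentation_single]

/-- The left ideal of `ℤM` generated by the elements `a - 1` with `a ∈ A`. -/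
noncomputable def differenceIdeal (A : Set M) :
    Submodule (MonoidAlgebra ℤ M) (MonoidAlgebra ℤ M) :=
  Submodule.span _ ((fun a => MonoidAlgebra.single a (1 : ℤ) - 1) '' A)

theorem differenceIdeal_le_ker_augmentation (A : Set M) :
    differenceIdeal A ≤ LinearMap.ker (augmentation M) := by
  rw [differenceIdeal, Submodule.span_le]
  rintro _ ⟨a, -, rfl⟩
  exact single_sub_one_mem_ker_augmentation a

/-- An element of the augmentation ideal lies in the left ideal generated by the `m - 1`, where
`m` runs through its support. -/
theorem mem_differenceIdeal_of_mem_ker_augmentation {A : Set M} {x : MonoidAlgebra ℤ M}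
    (hx : x ∈ LinearMap.ker (augmentation M))
    (hA : ∀ m ∈ x.coeff.support, MonoidAlgebra.single m (1 : ℤ) - 1 ∈ differenceIdeal A) :
    x ∈ differenceIdeal A := by
  have hsum : x = ∑ m ∈ x.coeff.support, MonoidAlgebra.single m (x.coeff m) :=
    (MonoidAlgebra.sum_coeff_single x).symm
  have h0 : ∑ m ∈ x.coeff.support, x.coeff m = 0 := by
    have := congrArg (trivialModuleEquivInt M) (LinearMap.mem_ker.mp hx)
    rw [hsum, map_sum, map_sum, map_zero] at this
    simpa only [trivialModuleEquivInt_augmentation_single] using this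
  -- The coefficients sum to 0, so replacing each `m` by `m - 1` subtracts nothing.
  have h1 : x = ∑ m ∈ x.coeff.support,
      x.coeff m • (MonoidAlgebra.single m (1 : ℤ) - 1 : MonoidAlgebra ℤ M) := by
    simp only [smul_sub, Finset.sum_sub_distrib, ← Finset.sum_smul, h0, zero_smul, sub_zero]
    simpa using hsum
  rw [h1]
  exact Submodule.sum_mem _ fun m hm => zsmul_mem (hA m hm) _

/-- Along an arc, `x - xa = -x(a - 1)`; along a zigzag these differences telescope. -/
theorem single_sub_one_mem_differenceIdeal {A : Set M} {x y : M}
    (h : Relation.EqvGen (CayleyAdj A) x y) :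
    MonoidAlgebra.single x (1 : ℤ) - MonoidAlgebra.single y 1 ∈ differenceIdeal A := by
  induction h with
  | rel x y h =>
    obtain ⟨a, ha, rfl⟩ := h
    have := neg_mem ((differenceIdeal A).smul_mem (MonoidAlgebra.single x (1 : ℤ))
      (Submodule.subset_span ⟨a, ha, rfl⟩))
    simpa [mul_sub, MonoidAlgebra.single_mul_single] using this
  | refl x => simp
  | symm x y _ ih => simpa using neg_mem ih
  | trans x y z _ _ ih₁ ih₂ => simpa using add_mem ih₁ ih₂

/-- The additive map sending `ℤM` to the free abelian group on the components of `Γ(M, A)`. -/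
noncomputable def componentMap (A : Set M) :
    MonoidAlgebra ℤ M →+ (Quot (CayleyAdj A) →₀ ℤ) :=
  (Finsupp.mapDomain.addMonoidHom (Quot.mk (CayleyAdj A))).comp
    MonoidAlgebra.coeffAddEquiv.toAddMonoidHom

theorem componentMap_single (A : Set M) (m : M) (n : ℤ) :
    componentMap A (MonoidAlgebra.single m n) = Finsupp.single (Quot.mk _ m) n :=
  Finsupp.mapDomain_single

/-- `componentMap` is only additive, so scalars are split into monomials; then `m(a - 1) = ma - m`
joins two vertices of one component. -/
theorem componentMap_eq_zero {A : Set M} {x : MonoidAlgebra ℤ M} (hx : x ∈ differenceIdeal A) :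
    componentMap A x = 0 := by
  induction hx using Submodule.closure_induction with
  | zero => exact map_zero _
  | add x y _ _ hx hy => rw [map_add, hx, hy, add_zero]
  | smul_mem r x h =>
    obtain ⟨a, ha, rfl⟩ := h
    induction r using MonoidAlgebra.induction_linear with
    | zero => rw [zero_smul, map_zero]
    | add r s hr hs => rw [add_smul, map_add, hr, hs, add_zero]
    | single m n =>
      have : Quot.mk (CayleyAdj A) (m * a) = Quot.mk _ m := (Quot.sound ⟨a, ha, rfl⟩).symm
      simp [mul_sub, MonoidAlgebra.single_mul_single, componentMap_single, this]

/-- Each `m - 1` has augmentation 0, so `m` and 1 give the same basis element of the free abelian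
group on components. -/
theorem connected_of_differenceIdeal_eq {A : Set M}
    (h : LinearMap.ker (augmentation M) ≤ differenceIdeal A) :
    IsConnectedUndirected (CayleyDigraph A) := by
  rw [isConnectedUndirected_cayleyDigraph_iff]
  intro m
  rw [← Quot.eq]
  have := componentMap_eq_zero (h (single_sub_one_mem_ker_augmentation m))
  rw [map_sub, MonoidAlgebra.one_def, componentMap_single, componentMap_single, sub_eq_zero] at this
  exact (Finsupp.single_left_injective one_ne_zero this).symm

/-- The augmentation ideal is finitely generated exactly when some `Γ(M, A)` with `A` finite is
connected. -/
theorem fg_ker_augmentation_iff :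
    (LinearMap.ker (augmentation M)).FG ↔
      ∃ A : Set M, A.Finite ∧ IsConnectedUndirected (CayleyDigraph A) := by
  constructor
  · rintro ⟨S, hS⟩
    refine ⟨⋃ x ∈ S, (x.coeff.support : Set M), S.finite_toSet.biUnion fun x _ =>
      x.coeff.support.finite_toSet, connected_of_differenceIdeal_eq ?_⟩
    rw [← hS, Submodule.span_le]
    intro x hx
    refine mem_differenceIdeal_of_mem_ker_augmentation (hS ▸ Submodule.subset_span hx) ?_
    intro m hm
    exact Submodule.subset_span ⟨m, Set.mem_biUnion hx hm, rfl⟩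
  · rintro ⟨A, hA, h⟩
    rw [isConnectedUndirected_cayleyDigraph_iff] at h
    have : LinearMap.ker (augmentation M) = differenceIdeal A :=
      le_antisymm (fun x hx => mem_differenceIdeal_of_mem_ker_augmentation hx fun m _ =>
        single_sub_one_mem_differenceIdeal (h m).symm) (differenceIdeal_le_ker_augmentation A)
    rw [this]
    exact Submodule.fg_span (hA.image _)

end Augmentation

/-! ## Type left-`FP₁` -/

section Resolution

universe v w

variable {C : Type w} [Category.{v} C] [Abelian C]

/-- In degree 0 the condition is exactness of `K₁ → K₀ → Z → 0`; in positive degrees the target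
vanishes. -/
theorem quasiIso_toSingle₀ {Z : C} {K : ChainComplex C ℕ}
    (π : K ⟶ (ChainComplex.single₀ C).obj Z) [Epi (π.f 0)] (w : K.d 1 0 ≫ π.f 0 = 0)
    (h₀ : (ShortComplex.mk (K.d 1 0) (π.f 0) w).Exact)
    (h : ∀ n, K.ExactAt (n + 1)) : QuasiIso π := by
  refine ⟨fun n => ?_⟩
  cases n
  · rw [ChainComplex.quasiIsoAt₀_iff, ShortComplex.quasiIso_iff_of_zeros']
    · refine (ShortComplex.exact_and_epi_g_iff_of_iso ?_).2 ⟨h₀, ‹_›⟩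
      exact ShortComplex.isoMk (Iso.refl _) (Iso.refl _) (Iso.refl _)
        ((Category.id_comp _).trans (Category.comp_id _).symm)
        ((Category.id_comp _).trans (Category.comp_id _).symm)
    · exact K.shape 0 0 (by simp)
    · rfl
    · rfl
  · rw [quasiIsoAt_iff_exactAt']
    · apply h
    · apply HomologicalComplex.exactAt_single_obj
      simp

variable [EnoughProjectives C] {Z X₀ X₁ : C} (p : X₀ ⟶ Z) (d : X₁ ⟶ X₀)

/-- A projective cover of the kernel of `f`, as a morphism to the source of `f`. -/
noncomputable def kernelCover {Y₀ Y₁ : C} (f : Y₁ ⟶ Y₀) : Σ' (Y₂ : C) (g : Y₂ ⟶ Y₁), g ≫ f = 0 :=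
  ⟨Projective.syzygies f, Projective.d f,
    (Category.assoc _ _ _).trans ((congrArg _ (kernel.condition f)).trans comp_zero)⟩

/-- The chain complex extending a morphism `X₁ ⟶ X₀` by projective covers of the successive
kernels. -/
noncomputable def extendedComplex : ChainComplex C ℕ :=
  ChainComplex.mk' X₀ X₁ d kernelCover

theorem extendedComplex_d_one_zero : (extendedComplex d).d 1 0 = d :=
  ChainComplex.mk'_d_1_0 ..

/-- The objects of the extended complex in degrees `≥ 2`. -/
noncomputable def extendedComplexIso (n : ℕ) :
    (extendedComplex d).X (n + 2) ≅ Projective.syzygies ((extendedComplex d).d (n + 1) n) :=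
  ChainComplex.mk'XIso X₀ X₁ d kernelCover n

theorem extendedComplex_d (n : ℕ) : (extendedComplex d).d (n + 2) (n + 1) =
    (extendedComplexIso d n).hom ≫ Projective.d ((extendedComplex d).d (n + 1) n) :=
  ChainComplex.mk'_d X₀ X₁ d kernelCover n

theorem extendedComplex_exactAt_succ (n : ℕ) : (extendedComplex d).ExactAt (n + 1) := by
  rw [HomologicalComplex.exactAt_iff' _ (n + 1 + 1) (n + 1) n (by simp) (by simp)]
  refine ShortComplex.exact_of_iso ?_ (exact_d_f ((extendedComplex d).d (n + 1) n))
  refine ShortComplex.isoMk (extendedComplexIso d n).symm (Iso.refl _) (Iso.refl _) ?_ ?_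
  · refine (congrArg _ (extendedComplex_d d n)).trans ?_
    exact ((extendedComplexIso d n).inv_hom_id_assoc _).trans (Category.comp_id _).symm
  · exact (Category.id_comp _).trans (Category.comp_id _).symm

theorem extendedComplex_projective [Projective X₀] [Projective X₁] (n : ℕ) :
    Projective ((extendedComplex d).X n) := by
  obtain (_ | _ | n) := n
  · exact inferInstanceAs (Projective X₀)
  · exact inferInstanceAs (Projective X₁)
  · exact Projective.of_iso (extendedComplexIso d n).symm (Projective.projective_over _)

variable (w : d ≫ p = 0)

/-- The augmentation of the extended complex. -/
noncomputable def extendedComplexAugmentation :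
    extendedComplex d ⟶ (ChainComplex.single₀ C).obj Z :=
  (ChainComplex.toSingle₀Equiv (extendedComplex d) Z).symm
    ⟨p, (congrArg (· ≫ p) (extendedComplex_d_one_zero d)).trans w⟩

theorem extendedComplexAugmentation_f_zero : (extendedComplexAugmentation p d w).f 0 = p :=
  ChainComplex.toSingle₀Equiv_symm_apply_f_zero ..

/-- A projective presentation `X₁ ⟶ X₀ ⟶ Z ⟶ 0` extends to a projective resolution. -/
noncomputable def extendedResolution [Projective X₀] [Projective X₁] [Epi p]
    (hw : (ShortComplex.mk d p w).Exact) : ProjectiveResolution Z where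
  complex := extendedComplex d
  projective := extendedComplex_projective d
  π := extendedComplexAugmentation p d w
  quasiIso := by
    have h₁ := extendedComplexAugmentation_f_zero p d w
    have : Epi ((extendedComplexAugmentation p d w).f 0) := by
      rw [h₁]
      exact ‹Epi p›
    refine quasiIso_toSingle₀ _ ?_ ?_ (extendedComplex_exactAt_succ d)
    · rw [extendedComplex_d_one_zero, h₁]
      exact w
    · refine ShortComplex.exact_of_iso ?_ hw
      exact ShortComplex.isoMk (Iso.refl _) (Iso.refl _) (Iso.refl _)
        ((Category.id_comp _).trans
          ((extendedComplex_d_one_zero d).trans (Category.comp_id _).symm))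
        ((Category.id_comp _).trans (h₁.trans (Category.comp_id _).symm))

end Resolution

/-! ### Finite presentation of `ℤ` and the augmentation ideal -/

section FP

/-- The kernel of `P₀ → ℤ` is the image of `P₁`, and `P₀` is finitely presented, so `ℤ` is too.
Hence any surjection onto `ℤ` from a finitely generated module, such as the augmentation, has
finitely generated kernel. -/
theorem IsLeftFP.fg_ker_augmentation {M : Type u} [Monoid M] (h : IsLeftFP 1 M) :
    (LinearMap.ker (augmentation M)).FG := by
  obtain ⟨P, hP⟩ := h
  have h₀ := hP 0 zero_le_one
  have h₁ := hP 1 le_rfl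
  have hproj : Module.Projective (MonoidAlgebra ℤ M) (P.complex.X 0) :=
    have := P.projective 0
    ModuleCat.projective_of_module_projective _
  have := Module.finitePresentation_of_projective (MonoidAlgebra ℤ M) (P.complex.X 0)
  have hsurj : Function.Surjective (P.π.f 0).hom :=
    (ModuleCat.epi_iff_surjective (P.π.f 0)).mp inferInstance
  have hker : (LinearMap.ker (P.π.f 0).hom).FG := by
    rw [← P.exact₀.moduleCat_range_eq_ker]
    rw [← Submodule.map_top]
    exact Module.Finite.fg_top.map _
  have hZ : Module.FinitePresentation (MonoidAlgebra ℤ M) (trivialModule M) :=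
    Module.finitePresentation_of_surjective (P.π.f 0).hom hsurj hker
  exact Module.FinitePresentation.fg_ker _ augmentation_surjective

theorem isLeftFP_one_of_fg_ker_augmentation {M : Type u} [Monoid M]
    (h : (LinearMap.ker (augmentation M)).FG) : IsLeftFP 1 M := by
  have : Module.Finite (MonoidAlgebra ℤ M) (LinearMap.ker (augmentation M)) := .of_fg h
  obtain ⟨n, f, hf⟩ :=
    Module.Finite.exists_fin' (MonoidAlgebra ℤ M) (LinearMap.ker (augmentation M))
  let X₀ : ModuleCat.{u} (MonoidAlgebra ℤ M) := ModuleCat.of _ (MonoidAlgebra ℤ M)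
  let X₁ : ModuleCat.{u} (MonoidAlgebra ℤ M) := ModuleCat.of _ (Fin n → MonoidAlgebra ℤ M)
  let p : X₀ ⟶ trivialModule M := ModuleCat.ofHom (augmentation M)
  let d : X₁ ⟶ X₀ := ModuleCat.ofHom ((LinearMap.ker (augmentation M)).subtype ∘ₗ f)
  have : Projective X₀ := ModuleCat.projective_of_categoryTheory_projective _
  have : Projective X₁ := ModuleCat.projective_of_categoryTheory_projective _
  have : Epi p := (ModuleCat.epi_iff_surjective p).mpr augmentation_surjective
  have w : d ≫ p = 0 := by
    ext x
    exact (f _).2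
  have hw : (ShortComplex.mk d p w).Exact := by
    rw [ShortComplex.moduleCat_exact_iff_range_eq_ker]
    change LinearMap.range ((LinearMap.ker (augmentation M)).subtype ∘ₗ f) = _
    rw [LinearMap.range_comp, LinearMap.range_eq_top.mpr hf, Submodule.map_top,
      Submodule.range_subtype]
    rfl
  refine ⟨extendedResolution p d w hw, fun k hk => ?_⟩
  interval_cases k
  · exact inferInstanceAs (Module.Finite (MonoidAlgebra ℤ M) (MonoidAlgebra ℤ M))
  · exact inferInstanceAs (Module.Finite (MonoidAlgebra ℤ M) (Fin n → MonoidAlgebra ℤ M))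

theorem isLeftFP_one_iff {M : Type u} [Monoid M] :
    IsLeftFP 1 M ↔
      ∃ A : Set M, A.Finite ∧ IsConnectedUndirected (CayleyDigraph A) :=
  ⟨fun h => fg_ker_augmentation_iff.mp h.fg_ker_augmentation,
    fun h => isLeftFP_one_of_fg_ker_augmentation (fg_ker_augmentation_iff.mpr h)⟩

end FP

/-! ## The 1-skeleton of a connected projective `M`-CW complex -/

/-- The free `M`-set on a set `J`, with the discrete topology. -/
def FreeAct (M J : Type u) : Type u := M × J

namespace FreeAct

variable {M J : Type u}

instance [Monoid M] : MulAction M (FreeAct M J) where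
  smul m x := (m * x.1, x.2)
  one_smul _ := Prod.ext (one_mul _) rfl
  mul_smul _ _ _ := Prod.ext (mul_assoc _ _ _) rfl

instance : TopologicalSpace (FreeAct M J) := ⊥

instance : DiscreteTopology (FreeAct M J) := ⟨rfl⟩

end FreeAct

/-- A projective `M`-set admits an equivariant map to the free `M`-set `M`. -/
theorem IsProjectiveAct.exists_equivariant_map {M : Type u} [Monoid M] {P : Type u} [MulAction M P]
    (hP : IsProjectiveAct M P) : ∃ φ : P → M, ∀ (m : M) (p : P), φ (m • p) = m * φ p := by
  -- The action map `M × P → P` is an equivariant surjection from a free `M`-set; the first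
  -- coordinate of a section of it is the required map.
  let f : FreeAct M P →[M] P :=
    { toFun := fun x => x.1 • x.2
      map_smul' := fun m x => mul_smul m x.1 x.2 }
  obtain ⟨s, -⟩ := hP (FreeAct M P) f fun p => ⟨(1, p), one_smul M p⟩
  exact ⟨fun p => (s p).1, fun m p => congrArg Prod.fst (map_smul s m p)⟩

theorem hom_ρ_apply {M : Type u} [Monoid M] {X Y : Action TopCat.{u} M} (f : X ⟶ Y) (m : M)
    (x : X.V) : f.hom (TopCat.Hom.hom (X.ρ m) x) = TopCat.Hom.hom (Y.ρ m) (f.hom x) :=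
  congrArg (fun g => g.hom x) (f.comm m)

theorem preconnectedSpace_diskBoundary {n : ℕ} (hn : 2 ≤ n) :
    PreconnectedSpace (TopCat.diskBoundary.{u} n) := by
  have h : IsPreconnected (Metric.sphere (0 : EuclideanSpace ℝ (Fin n)) 1) := by
    apply isPreconnected_sphere
    rw [← Module.finrank_eq_rank, finrank_euclideanSpace_fin]
    exact_mod_cast hn
  have := isPreconnected_iff_preconnectedSpace.mp h
  exact Homeomorph.ulift.symm.surjective.denseRange.preconnectedSpace
    Homeomorph.ulift.symm.continuous

/-- A 1-cell has finitely many ends, which makes the set `A` extracted from a complex finite. -/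
instance : Finite (TopCat.diskBoundary.{u} 1) := by
  refine Finite.of_injective
    (fun x => (⟨x.down.1 0, ?_⟩ : ({1, -1} : Set ℝ))) fun x y h => ?_
  · have := x.down.2
    rw [mem_sphere_zero_iff_norm, EuclideanSpace.norm_eq, Real.sqrt_eq_one, Fin.sum_univ_one,
      Real.norm_eq_abs, sq_abs, sq, mul_self_eq_one_iff] at this
    exact this
  · refine ULift.ext _ _ (Subtype.ext (PiLp.ext fun i => ?_))
    rw [Subsingleton.elim i 0]
    exact congrArg Subtype.val h

theorem nonempty_diskBoundary (n : ℕ) : Nonempty (TopCat.diskBoundary.{u} (n + 1)) :=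
  ⟨⟨EuclideanSpace.single 0 1, by simp⟩⟩

section

variable {M : Type u} [Monoid M] (X : ProjectiveCWComplex M)

namespace ProjectiveCWComplex

/-- The vertices of a 1-cell. -/
noncomputable def vertex (p : X.cells 1) (t : TopCat.diskBoundary.{u} 1) : X.cells 0 :=
  X.zeroIso.inv.hom ((X.attach 0).hom (p, t))

theorem vertex_smul (m : M) (p : X.cells 1) (t : TopCat.diskBoundary.{u} 1) :
    X.vertex (m • p) t = m • X.vertex p t := by
  have h₁ := hom_ρ_apply (X.attach 0) m (p, t)
  have h₂ := hom_ρ_apply X.zeroIso.inv m ((X.attach 0).hom (p, t))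
  exact (congrArg X.zeroIso.inv.hom h₁).trans h₂

/-- Two vertices are adjacent if they are vertices of the same 1-cell. -/
def VertexAdj (x y : X.cells 0) : Prop := ∃ p s t, X.vertex p s = x ∧ X.vertex p t = y

theorem VertexAdj.smul {x y : X.cells 0} (m : M) (h : X.VertexAdj x y) :
    X.VertexAdj (m • x) (m • y) := by
  obtain ⟨p, s, t, rfl, rfl⟩ := h
  exact ⟨m • p, s, t, X.vertex_smul m p s, X.vertex_smul m p t⟩

/-- The components of the 1-skeleton. -/
def Components : Type u := Quot X.VertexAdj

instance : MulAction M X.Components where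
  smul m := Quot.map (m • ·) fun _ _ h => VertexAdj.smul X m h
  one_smul := by
    rintro ⟨x⟩
    exact congrArg (Quot.mk _) (one_smul M x)
  mul_smul := by
    rintro m n ⟨x⟩
    exact congrArg (Quot.mk _) (mul_smul m n x)

instance : TopologicalSpace X.Components := ⊥

instance : DiscreteTopology X.Components := ⟨rfl⟩

/-- The equivariant map from the 0-skeleton to the set of components. -/
noncomputable def toComponentsZero : X.skeleton 0 ⟶ discreteSpace M X.Components :=
  X.zeroIso.inv ≫
    { hom := TopCat.ofHom ⟨fun p : X.cells 0 => (Quot.mk _ p : X.Components),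
        continuous_of_discreteTopology⟩
      comm := fun _ => rfl }

/-- The equivariant map is constant on the boundary of each `(n + 1)`-cell. -/
def IsConstantOnBoundaries (n : ℕ) (Q : Type u) [MulAction M Q] [TopologicalSpace Q]
    [DiscreteTopology Q] (φ : X.skeleton n ⟶ discreteSpace M Q) : Prop :=
  ∀ (p : X.cells (n + 1)) (s t : TopCat.diskBoundary.{u} (n + 1)),
    φ.hom ((X.attach n).hom (p, s)) = φ.hom ((X.attach n).hom (p, t))

theorem isConstantOnBoundaries_toComponentsZero :
    X.IsConstantOnBoundaries 0 X.Components X.toComponentsZero := fun p s t =>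
  Quot.sound ⟨p, s, t, rfl, rfl⟩

-- The map extends by a constant on each `(n + 1)`-cell. The next cells have boundary `Sⁿ⁺¹`, which
-- is connected, so a map to a discrete set is automatically constant there and the extension can be
-- iterated.
variable {X} in
theorem IsConstantOnBoundaries.exists_extension {n : ℕ} {Q : Type u} [MulAction M Q]
    [TopologicalSpace Q] [DiscreteTopology Q] {φ : X.skeleton n ⟶ discreteSpace M Q}
    (h : X.IsConstantOnBoundaries n Q φ) :
    ∃ ψ : X.skeleton (n + 1) ⟶ discreteSpace M Q,
      X.IsConstantOnBoundaries (n + 1) Q ψ ∧ X.incl n ≫ ψ = φ := by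
  obtain ⟨b⟩ := nonempty_diskBoundary.{u} n
  let f : X.cells (n + 1) → Q := fun p => φ.hom ((X.attach n).hom (p, b))
  let g : prodTrivial M (X.cells (n + 1)) (TopCat.disk.{u} (n + 1)) ⟶ discreteSpace M Q :=
    { hom := TopCat.ofHom ⟨fun x : X.cells (n + 1) × TopCat.disk.{u} (n + 1) => f x.1,
        (continuous_of_discreteTopology (f := f)).comp continuous_fst⟩
      comm := fun m => by
        ext x
        exact hom_ρ_apply (X.attach n ≫ φ) m (x.1, b) }
  have hg : X.attach n ≫ φ =
      prodTrivialMap M (X.cells (n + 1)) (TopCat.diskBoundaryInclusion.{u} (n + 1)) ≫ g := by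
    ext x
    exact h x.1 x.2 b
  refine ⟨(X.isPushout n).desc φ g hg, fun p s t => ?_, (X.isPushout n).inl_desc _ _ _⟩
  have := preconnectedSpace_diskBoundary.{u} (n := n + 2) (by omega)
  set ψ := (X.isPushout n).desc φ g hg
  have hc : Continuous fun t : TopCat.diskBoundary.{u} (n + 2) =>
      (show Q from ψ.hom ((X.attach (n + 1)).hom (p, t))) :=
    (X.attach (n + 1) ≫ ψ).hom.hom.continuous.comp (Continuous.prodMk_right p)
  exact PreconnectedSpace.constant inferInstance hc

theorem exists_map_to_components :
    ∃ φ : X.cocone.pt ⟶ discreteSpace M X.Components,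
      X.cocone.ι.app 0 ≫ φ = X.toComponentsZero := by
  choose ext hext using fun n (φ : {φ // X.IsConstantOnBoundaries n X.Components φ}) =>
    φ.2.exists_extension
  let φ : ∀ n, {φ // X.IsConstantOnBoundaries n X.Components φ} := fun n =>
    Nat.rec ⟨X.toComponentsZero, X.isConstantOnBoundaries_toComponentsZero⟩
      (fun n φ => ⟨ext n φ, (hext n φ).1⟩) n
  have hφ : ∀ n, X.incl n ≫ (φ (n + 1)).1 = (φ n).1 := fun n => (hext n (φ n)).2
  let c : Cocone (Functor.ofSequence X.incl) :=
    { pt := discreteSpace M X.Components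
      ι := NatTrans.ofSequence (fun n => (φ n).1) fun n => by
        rw [Functor.ofSequence_map_homOfLE_succ]
        exact (hφ n).trans (Category.comp_id _).symm }
  exact ⟨X.isColimit.desc c, X.isColimit.fac c 0⟩

variable {X}

/-- The map from `X` to the discrete set of components is constant by connectedness, yet sends each
vertex to its own component. -/
theorem eqvGen_vertexAdj [PreconnectedSpace X.space] (x y : X.cells 0) :
    Relation.EqvGen X.VertexAdj x y := by
  obtain ⟨φ, hφ⟩ := X.exists_map_to_components
  rw [← Quot.eq]
  have hc : Continuous fun z : X.space => (show X.Components from φ.hom z) :=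
    φ.hom.hom.continuous
  have hconst : ∀ x y : X.space, (show X.Components from φ.hom x) = φ.hom y := fun x y =>
    ‹PreconnectedSpace X.space›.constant hc
  have key : ∀ x : X.cells 0, (show X.Components from
      φ.hom ((X.cocone.ι.app 0).hom (X.zeroIso.hom.hom x))) = Quot.mk _ x := by
    intro x
    have h₁ := congrArg (fun f => f.hom (X.zeroIso.hom.hom x)) hφ
    refine h₁.trans (congrArg (Quot.mk _) ?_)
    exact congrArg (fun f => f.hom x) X.zeroIso.hom_inv_id
  rw [← key x, ← key y]
  exact hconst _ _

theorem nonempty_cells_zero [Nonempty X.space] : Nonempty (X.cells 0) := by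
  obtain ⟨φ, -⟩ := X.exists_map_to_components
  obtain ⟨x⟩ := ‹Nonempty X.space›
  obtain ⟨p, -⟩ := Quot.exists_rep (show X.Components from φ.hom x)
  exact ⟨p⟩

theorem exists_finite_connected_cayleyDigraph [ConnectedSpace X.space]
    (h : IsFinitelyGeneratedAct M (X.cells 1)) :
    ∃ A : Set M, A.Finite ∧ IsConnectedUndirected (CayleyDigraph A) := by
  obtain ⟨φ, hφ⟩ := (X.projective 0).exists_equivariant_map
  obtain ⟨p₀⟩ := X.nonempty_cells_zero
  obtain ⟨S, hS⟩ := h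
  -- The ends of a 1-cell `m • q`, `q ∈ S`, map to `m * φ v` with `v` an end of `q`, so both are one
  -- arc away from `m`. The element `φ p₀` links each `m` to `φ (m • p₀)`.
  let A : Set M := insert (φ p₀) ((fun x : X.cells 1 × TopCat.diskBoundary.{u} 1 =>
    φ (X.vertex x.1 x.2)) '' ((S : Set (X.cells 1)) ×ˢ Set.univ))
  refine ⟨A, ((S.finite_toSet.prod Set.finite_univ).image _).insert _, ?_⟩
  rw [isConnectedUndirected_cayleyDigraph_iff]
  have hadj : ∀ x y, Relation.EqvGen X.VertexAdj x y →
      Relation.EqvGen (CayleyAdj A) (φ x) (φ y) := by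
    intro x y hxy
    induction hxy with
    | rel x y h =>
      obtain ⟨p, s, t, rfl, rfl⟩ := h
      obtain ⟨q, hq, m, rfl⟩ := hS p
      have : ∀ t, Relation.EqvGen (CayleyAdj A) m (φ (X.vertex (m • q) t)) := fun t => by
        rw [vertex_smul, hφ]
        exact .rel _ _ ⟨_, Or.inr ⟨(q, t), ⟨hq, trivial⟩, rfl⟩, rfl⟩
      exact (this s).symm.trans _ _ _ (this t)
    | refl x => exact .refl _
    | symm x y _ ih => exact ih.symm
    | trans x y z _ _ ih₁ ih₂ => exact ih₁.trans _ _ _ ih₂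
  have hp₀ : ∀ m, Relation.EqvGen (CayleyAdj A) m (φ (m • p₀)) := fun m => by
    rw [hφ]
    exact .rel _ _ ⟨_, Or.inl rfl, rfl⟩
  intro m
  have h₁ := hp₀ 1
  rw [one_smul] at h₁
  exact (h₁.trans _ _ _ (hadj _ _ (eqvGen_vertexAdj p₀ (m • p₀)))).trans _ _ _ (hp₀ m).symm

end ProjectiveCWComplex

theorem IsLeftF.exists_finite_connected_cayleyDigraph (h : IsLeftF 1 M) :
    ∃ A : Set M, A.Finite ∧ IsConnectedUndirected (CayleyDigraph A) := by
  obtain ⟨X, hX, hfin⟩ := h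
  have : ContractibleSpace X.space := hX
  exact X.exists_finite_connected_cayleyDigraph (hfin 1 le_rfl)

end

/-! ## Contracting a projective `M`-CW complex -/

section Cylinder

open scoped unitInterval
open Metric

theorem isEmbedding_diskBoundaryInclusion (n : ℕ) :
    Topology.IsEmbedding (TopCat.diskBoundaryInclusion.{u} n) := by
  have : T2Space (TopCat.disk.{u} n) := Homeomorph.ulift.symm.t2Space
  exact ((TopCat.diskBoundaryInclusion.{u} n).hom.continuous.isClosedEmbedding
    ((TopCat.mono_iff_injective _).mp inferInstance)).isEmbedding

theorem mem_range_diskBoundaryInclusion {n : ℕ} (x : TopCat.disk.{u} n) :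
    x ∈ Set.range (TopCat.diskBoundaryInclusion.{u} n) ↔
      x.down.1 ∈ sphere (0 : EuclideanSpace ℝ (Fin n)) 1 := by
  constructor
  · rintro ⟨⟨y⟩, rfl⟩
    exact y.2
  · intro h
    exact ⟨⟨⟨x.down.1, h⟩⟩, rfl⟩

/-- The pair `(Bⁿ × [0, 1], ∂(Bⁿ × [0, 1]))` is homeomorphic to `(Bⁿ⁺¹, Sⁿ)`. -/
theorem exists_homeomorph_cylinder (n : ℕ) :
    ∃ h : EuclideanSpace ℝ (Fin n) × ℝ ≃ₜ EuclideanSpace ℝ (Fin (n + 1)),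
      (∀ p, h p ∈ closedBall 0 1 ↔ p ∈ closedBall 0 1 ×ˢ Set.Icc (0 : ℝ) 1) ∧
      (∀ p, h p ∈ sphere 0 1 ↔ p ∈ frontier (closedBall 0 1 ×ˢ Set.Icc (0 : ℝ) 1)) := by
  have hfin : Module.finrank ℝ (EuclideanSpace ℝ (Fin n) × ℝ) =
      Module.finrank ℝ (EuclideanSpace ℝ (Fin (n + 1))) := by simp
  let e : (EuclideanSpace ℝ (Fin n) × ℝ) ≃L[ℝ] EuclideanSpace ℝ (Fin (n + 1)) :=
    ContinuousLinearEquiv.ofFinrankEq hfin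
  let K : Set (EuclideanSpace ℝ (Fin n) × ℝ) := closedBall 0 1 ×ˢ Set.Icc (0 : ℝ) 1
  have hK : IsCompact K := (isCompact_closedBall _ _).prod isCompact_Icc
  have hKc : Convex ℝ K := (convex_closedBall _ _).prod (convex_Icc _ _)
  have hKi : (interior K).Nonempty := by
    rw [interior_prod_eq, interior_Icc]
    exact (Set.Nonempty.prod ⟨0, ball_subset_interior_closedBall (mem_ball_self one_pos)⟩
      ⟨1 / 2, by norm_num⟩)
  -- A bounded convex set with nonempty interior is carried to the unit ball by a homeomorphism of
  -- its ambient space, so `e` first places the cylinder in `ℝⁿ⁺¹`.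
  obtain ⟨g, -, hg₁, hg₂⟩ := exists_homeomorph_image_interior_closure_frontier_eq_unitBall
    (s := e '' K) (hKc.is_linear_image e.toLinearMap.isLinear)
    (by
      rw [← e.coe_toHomeomorph, ← Homeomorph.image_interior]
      exact hKi.image _)
    (hK.image e.continuous).isBounded
  refine ⟨e.toHomeomorph.trans g, fun p => ?_, fun p => ?_⟩
  · rw [← hg₁, (hK.image e.continuous).isClosed.closure_eq]
    change g (e p) ∈ _ ↔ _
    rw [g.injective.mem_set_image, e.injective.mem_set_image]
  · rw [← hg₂, ← e.coe_toHomeomorph, ← Homeomorph.image_frontier]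
    change g (e p) ∈ _ ↔ _
    rw [g.injective.mem_set_image]
    exact e.injective.mem_set_image

theorem exists_cylinder_to_disk (n : ℕ) :
    ∃ θ : C(TopCat.disk.{u} n × I, TopCat.disk.{u} (n + 1)),
      Function.Bijective θ ∧ ∀ p, θ p ∈ Set.range (TopCat.diskBoundaryInclusion.{u} (n + 1)) ↔
        p.2 = 0 ∨ p.2 = 1 ∨ p.1 ∈ Set.range (TopCat.diskBoundaryInclusion.{u} n) := by
  obtain ⟨h, h₁, h₂⟩ := exists_homeomorph_cylinder n
  refine ⟨⟨fun p => ⟨⟨h (p.1.down.1, p.2.1), (h₁ _).mpr ⟨p.1.down.2, p.2.2⟩⟩⟩, ?_⟩,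
    ⟨fun p q hpq => ?_, fun z => ?_⟩, fun p => ?_⟩
  · refine continuous_uliftUp.comp (Continuous.subtype_mk (h.continuous.comp ?_) _)
    exact (continuous_subtype_val.comp (continuous_uliftDown.comp continuous_fst)).prodMk
      (continuous_subtype_val.comp continuous_snd)
  · have := h.injective (congrArg (fun z => z.down.1) hpq)
    rw [Prod.mk.injEq] at this
    exact Prod.ext (ULift.ext _ _ (Subtype.ext this.1)) (Subtype.ext this.2)
  · have hz := (h₁ (h.symm z.down.1)).mp (by rw [h.apply_symm_apply]; exact z.down.2)
    refine ⟨(⟨⟨_, hz.1⟩⟩, ⟨_, hz.2⟩), ULift.ext _ _ (Subtype.ext ?_)⟩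
    exact h.apply_symm_apply _
  · rw [mem_range_diskBoundaryInclusion, mem_range_diskBoundaryInclusion]
    refine (h₂ _).trans ?_
    rw [frontier_prod_eq, frontier_Icc zero_le_one, frontier_closedBall _ one_ne_zero,
      isClosed_closedBall.closure_eq, isClosed_Icc.closure_eq]
    have hp := p.1.down.2
    have ht := p.2.2
    simp only [Set.mem_union, Set.mem_prod, hp, ht, true_and, and_true, Set.mem_insert_iff,
      Set.mem_singleton_iff, or_assoc]
    simp only [Subtype.ext_iff, Set.Icc.coe_zero, Set.Icc.coe_one]

/-- If every `n`-sphere in `Y` bounds in `Z`, then a homotopy on the boundary of an `n`-disk from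
the restriction of `c` to a constant map extends, in `Z`, to the disk. -/
theorem exists_homotopy_extension {n : ℕ} {Y Z : TopCat.{u}} (i : Y ⟶ Z)
    (hi : ∀ f : TopCat.diskBoundary.{u} (n + 1) ⟶ Y, ∃ g : TopCat.disk.{u} (n + 1) ⟶ Z,
      TopCat.diskBoundaryInclusion (n + 1) ≫ g = f ≫ i)
    (c : C(TopCat.disk.{u} n, Y)) (k : C(TopCat.diskBoundary.{u} n, C(I, Y))) (b : Y)
    (h₀ : ∀ s, k s 0 = c (TopCat.diskBoundaryInclusion n s)) (h₁ : ∀ s, k s 1 = b) :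
    ∃ G : C(TopCat.disk.{u} n, C(I, Z)), (∀ x, G x 0 = i (c x)) ∧ (∀ x, G x 1 = i b) ∧
      ∀ s, G (TopCat.diskBoundaryInclusion n s) = i.hom.comp (k s) := by
  obtain ⟨θ, hθ, hθb⟩ := exists_cylinder_to_disk.{u} n
  -- `w` covers the boundary of the cylinder by bottom, top and side; `F` is the prescribed map on
  -- these pieces. Through `θ` they cover `Sⁿ`, and `F` descends to a map on this sphere, which is
  -- then filled.
  let w : TopCat.disk.{u} n ⊕ TopCat.disk.{u} n ⊕ (TopCat.diskBoundary.{u} n × I) →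
      TopCat.disk.{u} n × I :=
    Sum.elim (fun x => (x, 0)) (Sum.elim (fun x => (x, 1))
      fun x => (TopCat.diskBoundaryInclusion n x.1, x.2))
  have hw : Continuous w :=
    (Continuous.prodMk_left 0).sumElim ((Continuous.prodMk_left 1).sumElim
      (((TopCat.diskBoundaryInclusion n).hom.continuous.comp continuous_fst).prodMk
        continuous_snd))
  let F : TopCat.disk.{u} n ⊕ TopCat.disk.{u} n ⊕ (TopCat.diskBoundary.{u} n × I) → Y :=
    Sum.elim c (Sum.elim (fun _ => b) fun x => k x.1 x.2)
  have hF : Continuous F :=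
    c.continuous.sumElim (continuous_const.sumElim
      (ContinuousEval.continuous_eval.comp
        ((k.continuous.comp continuous_fst).prodMk continuous_snd)))
  have hwb : ∀ u, θ (w u) ∈ Set.range (TopCat.diskBoundaryInclusion.{u} (n + 1)) := by
    intro u
    rw [hθb]
    rcases u with x | x | x
    · exact Or.inl rfl
    · exact Or.inr (Or.inl rfl)
    · exact Or.inr (Or.inr ⟨_, rfl⟩)
  choose q hq using hwb
  have hqc : Continuous q := by
    rw [(isEmbedding_diskBoundaryInclusion (n + 1)).continuous_iff]
    exact (θ.continuous.comp hw).congr fun u => (hq u).symm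
  have hqs : Function.Surjective q := by
    intro z
    obtain ⟨p, hp⟩ := hθ.2 (TopCat.diskBoundaryInclusion.{u} (n + 1) z)
    suffices h : ∃ u, w u = p by
      obtain ⟨u, rfl⟩ := h
      exact ⟨u, (isEmbedding_diskBoundaryInclusion (n + 1)).injective ((hq u).trans hp)⟩
    obtain ⟨x, t⟩ := p
    rcases (hθb (x, t)).mp ⟨z, hp.symm⟩ with h | h | ⟨s, h⟩
    · exact ⟨Sum.inl x, Prod.ext rfl h.symm⟩
    · exact ⟨Sum.inr (Sum.inl x), Prod.ext rfl h.symm⟩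
    · exact ⟨Sum.inr (Sum.inr (s, t)), Prod.ext h rfl⟩
  have hqF : ∀ u v, q u = q v → F u = F v := by
    intro u v huv
    have huv : w u = w v := hθ.1 (by rw [← hq, ← hq, huv])
    have hinj := (isEmbedding_diskBoundaryInclusion.{u} n).injective
    rcases u with x | x | ⟨s, t⟩ <;> rcases v with y | y | ⟨s', t'⟩ <;>
      obtain ⟨hx, ht⟩ := Prod.ext_iff.mp huv <;> simp only [w, Sum.elim_inl, Sum.elim_inr] at hx ht
    · exact congrArg c hx
    · exact absurd ht zero_ne_one
    · exact (hx ▸ ht ▸ (h₀ s').symm :)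
    · exact absurd ht one_ne_zero
    · rfl
    · exact (ht ▸ (h₁ s').symm :)
    · exact (hx ▸ ht ▸ h₀ s :)
    · exact (ht ▸ h₁ s :)
    · obtain rfl := hinj hx
      exact congrArg (k s) ht
  have : T2Space (TopCat.diskBoundary.{u} (n + 1)) := Homeomorph.ulift.symm.t2Space
  have hquot : Topology.IsQuotientMap q := hqc.isClosedMap.isQuotientMap hqc hqs
  let f : C(TopCat.diskBoundary.{u} (n + 1), Y) :=
    Topology.IsQuotientMap.lift (f := ⟨q, hqc⟩) hquot ⟨F, hF⟩ fun u v => hqF u v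
  have hf : ∀ u, f (q u) = F u := fun u =>
    congrArg (fun φ => φ u) (Topology.IsQuotientMap.lift_comp (f := ⟨q, hqc⟩) hquot ⟨F, hF⟩
      fun u v => hqF u v)
  obtain ⟨g, hg⟩ := hi (TopCat.ofHom f)
  have key : ∀ u, g (θ (w u)) = i (F u) := fun u => by
    rw [← hq, ← hf]
    exact congrArg (fun φ => φ (q u)) hg
  refine ⟨(g.hom.comp θ).curry, fun x => key (Sum.inl x), fun x => key (Sum.inr (Sum.inl x)),
    fun s => ContinuousMap.ext fun t => key (Sum.inr (Sum.inr (s, t)))⟩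

end Cylinder

/-! ### Path spaces and contractions of the skeleta -/

section

open scoped unitInterval

/-- The space of paths of `Y`. -/
abbrev pathSpace (Y : TopCat.{u}) : TopCat.{u} := TopCat.of C(I, Y)

/-- The map of path spaces induced by a continuous map. -/
def pathSpaceMap {Y Z : TopCat.{u}} (f : Y ⟶ Z) : pathSpace Y ⟶ pathSpace Z :=
  TopCat.ofHom ⟨fun γ => f.hom.comp γ, ContinuousMap.continuous_postcomp _⟩

/-- The endpoint map of the path space. -/
def pathSpaceEval (Y : TopCat.{u}) (t : I) : pathSpace Y ⟶ Y :=
  TopCat.ofHom ⟨fun γ => γ t, ContinuousEvalConst.continuous_eval_const t⟩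

namespace ProjectiveCWComplex

variable {M : Type u} [Monoid M] (X : ProjectiveCWComplex M)

/-- The image of a vertex in the skeleta. -/
noncomputable def base (b : (X.skeleton 0).V) : ∀ n, (X.skeleton n).V
  | 0 => b
  | n + 1 => (X.incl n).hom (base b n)

/-- A contraction of `Xₙ` in `Xₙ₊₁` to the base point. -/
structure Contraction (b : (X.skeleton 0).V) (n : ℕ) where
  /-- the map sending a point to the path that it traverses -/
  map : (X.skeleton n).V ⟶ pathSpace (X.skeleton (n + 1)).V
  map_zero : ∀ x, map x 0 = (X.incl n).hom x
  map_one : ∀ x, map x 1 = X.base b (n + 1)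

variable {X}

/-- The contraction fixes one base point and need not be equivariant, so it is glued in plain
spaces. -/
theorem isPushout_forget (n : ℕ) : IsPushout (X.attach n).hom
    (prodTrivialMap M (X.cells (n + 1)) (TopCat.diskBoundaryInclusion.{u} (n + 1))).hom
    (X.incl n).hom (X.char n).hom :=
  (X.isPushout n).map (Action.forget TopCat.{u} M)

/-- The 0-skeleton is discrete, so any choice of paths is continuous. -/
theorem exists_contraction_zero (b : (X.skeleton 0).V)
    (h : ∀ x : (X.skeleton 0).V, Joined ((X.incl 0).hom x) ((X.incl 0).hom b)) :
    Nonempty (X.Contraction b 0) := by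
  let f : X.cells 0 → C(I, (X.skeleton 1).V) := fun p => (h (X.zeroIso.hom.hom p)).somePath
  have hx : ∀ x : (X.skeleton 0).V, X.zeroIso.hom.hom (X.zeroIso.inv.hom x) = x := fun x =>
    congrArg (fun f => f.hom x) X.zeroIso.inv_hom_id
  refine ⟨⟨X.zeroIso.inv.hom ≫
    TopCat.ofHom (Y := C(I, (X.skeleton 1).V)) ⟨f, continuous_of_discreteTopology⟩,
    fun x => ?_, fun x => ?_⟩⟩
  · exact (Path.source _).trans (congrArg _ (hx x))
  · exact Path.target _

/-- For an `(n + 1)`-cell, the characteristic map at time 0, the base point at time 1 and the given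
contraction on the boundary form an `(n + 1)`-sphere in `Xₙ₊₁`, which bounds in `Xₙ₊₂`. A homotopy
viewed as a map to a path space is a map out of the pushout, so the cells glue by its universal
property. -/
theorem Contraction.exists_succ {b : (X.skeleton 0).V} {n : ℕ} (h : X.Contraction b n)
    (hext : ∀ f : TopCat.diskBoundary.{u} (n + 2) ⟶ (X.skeleton (n + 1)).V,
      ∃ g : TopCat.disk.{u} (n + 2) ⟶ (X.skeleton (n + 2)).V,
        TopCat.diskBoundaryInclusion (n + 2) ≫ g = f ≫ (X.incl (n + 1)).hom) :
    ∃ h' : X.Contraction b (n + 1),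
      (X.incl n).hom ≫ h'.map = h.map ≫ pathSpaceMap (X.incl (n + 1)).hom := by
  have hw (p s) : (X.incl n).hom ((X.attach n).hom (p, s)) =
      (X.char n).hom (p, TopCat.diskBoundaryInclusion (n + 1) s) :=
    congrArg (fun f => f.hom (p, s)) (isPushout_forget (X := X) n).w
  choose G hG₀ hG₁ hG using fun p : X.cells (n + 1) =>
    exists_homotopy_extension (X.incl (n + 1)).hom hext
      ⟨fun x => (X.char n).hom (p, x), (X.char n).hom.hom.continuous.comp (.prodMk_right p)⟩
      ⟨fun s => h.map ((X.attach n).hom (p, s)),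
        ((X.attach n).hom ≫ h.map).hom.continuous.comp (.prodMk_right p)⟩
      (X.base b (n + 1)) (fun s => (h.map_zero _).trans (hw p s)) (fun s => h.map_one _)
  let g : (prodTrivial M (X.cells (n + 1)) (TopCat.disk.{u} (n + 1))).V ⟶
      pathSpace (X.skeleton (n + 2)).V :=
    TopCat.ofHom (X := X.cells (n + 1) × TopCat.disk.{u} (n + 1))
      ⟨fun x => G x.1 x.2, continuous_prod_of_discrete_left.mpr fun p => (G p).continuous⟩
  have hg : (X.attach n).hom ≫ h.map ≫ pathSpaceMap (X.incl (n + 1)).hom =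
      (prodTrivialMap M (X.cells (n + 1)) (TopCat.diskBoundaryInclusion.{u} (n + 1))).hom ≫ g := by
    ext x
    exact congrArg (fun γ : C(I, (X.skeleton (n + 2)).V) => γ _) (hG x.1 x.2).symm
  have hpo := isPushout_forget (X := X) n
  have hev : ∀ (t : I) (φ : (X.skeleton (n + 1)).V ⟶ (X.skeleton (n + 2)).V),
      (∀ x, (h.map ≫ pathSpaceMap (X.incl (n + 1)).hom) x t = φ ((X.incl n).hom x)) →
      (∀ p x, G p x t = φ ((X.char n).hom (p, x))) →
      hpo.desc _ g hg ≫ pathSpaceEval _ t = φ := by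
    intro t φ h₁ h₂
    apply hpo.hom_ext
    · rw [hpo.inl_desc_assoc]
      ext x
      exact h₁ x
    · rw [hpo.inr_desc_assoc]
      ext x
      exact h₂ x.1 x.2
  refine ⟨⟨hpo.desc _ g hg, fun x => ?_, fun x => ?_⟩, hpo.inl_desc _ _ _⟩
  · have := hev 0 (X.incl (n + 1)).hom (fun x => congrArg (X.incl (n + 1)).hom (h.map_zero x))
      fun p x => hG₀ p x
    exact congrArg (fun f => f.hom x) this
  · have := hev 1 (TopCat.ofHom (ContinuousMap.const _ (X.base b (n + 2))))
      (fun x => congrArg (X.incl (n + 1)).hom (h.map_one x)) fun p x => hG₁ p x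
    exact congrArg (fun f => f.hom x) this

/-- A projective `M`-CW complex is contractible as soon as its vertices can be joined in the
1-skeleton and every `n`-sphere in the `n`-skeleton bounds in the `(n + 1)`-skeleton for
`n ≥ 1`. -/
theorem contractibleSpace_of_exists_extension (b : (X.skeleton 0).V)
    (h : ∀ x : (X.skeleton 0).V, Joined ((X.incl 0).hom x) ((X.incl 0).hom b))
    (hext : ∀ (n : ℕ) (f : TopCat.diskBoundary.{u} (n + 2) ⟶ (X.skeleton (n + 1)).V),
      ∃ g : TopCat.disk.{u} (n + 2) ⟶ (X.skeleton (n + 2)).V,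
        TopCat.diskBoundaryInclusion (n + 2) ≫ g = f ≫ (X.incl (n + 1)).hom) :
    ContractibleSpace X.space := by
  obtain ⟨h₀⟩ := exists_contraction_zero b h
  choose next hnext using fun n (h : X.Contraction b n) => h.exists_succ (hext n)
  let H : ∀ n, X.Contraction b n := fun n => Nat.rec h₀ next n
  have hH : ∀ n, (X.incl n).hom ≫ (H (n + 1)).map =
      (H n).map ≫ pathSpaceMap (X.incl (n + 1)).hom := fun n => hnext n (H n)
  let ι : ∀ n, (X.skeleton n).V ⟶ X.space := fun n => (X.cocone.ι.app n).hom
  have hι : ∀ n, (X.incl n).hom ≫ ι (n + 1) = ι n := by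
    intro n
    have := X.cocone.w (homOfLE (Nat.le_add_right n 1))
    rw [Functor.ofSequence_map_homOfLE_succ] at this
    exact congrArg Action.Hom.hom this
  have hlim : IsColimit ((Action.forget TopCat.{u} M).mapCocone X.cocone) :=
    isColimitOfPreserves (Action.forget TopCat.{u} M) X.isColimit
  -- Successive contractions agree once pushed forward into `X`, so they form a cocone with values
  -- in its path space.
  let c : Cocone (Functor.ofSequence X.incl ⋙ Action.forget TopCat.{u} M) :=
    { pt := pathSpace X.space
      ι := NatTrans.ofSequence (F := Functor.ofSequence X.incl ⋙ Action.forget TopCat.{u} M)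
        (fun n => (H n).map ≫ pathSpaceMap (ι (n + 1))) fun n => by
        rw [Functor.comp_map, Functor.ofSequence_map_homOfLE_succ]
        refine Eq.trans ?_ (Category.comp_id _).symm
        change (X.incl n).hom ≫ (H (n + 1)).map ≫ pathSpaceMap (ι (n + 2)) = _
        rw [reassoc_of% (hH n), ← hι (n + 1)]
        rfl }
  let K : X.space ⟶ pathSpace X.space := hlim.desc c
  have hK : ∀ n, ι n ≫ K = (H n).map ≫ pathSpaceMap (ι (n + 1)) := fun n => hlim.fac c n
  have hbase : ∀ n, ι n (X.base b n) = ι 0 b := by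
    intro n
    induction n with
    | zero => rfl
    | succ n ih => exact (congrArg (fun f => f.hom (X.base b n)) (hι n)).trans ih
  have hK₀ : K ≫ pathSpaceEval _ 0 = 𝟙 _ := by
    refine hlim.hom_ext fun n => ?_
    change ι n ≫ K ≫ pathSpaceEval _ 0 = ι n ≫ 𝟙 _
    rw [reassoc_of% (hK n), Category.comp_id]
    ext x
    exact (congrArg (ι (n + 1)) ((H n).map_zero x)).trans (congrArg (fun f => f.hom x) (hι n))
  have hK₁ : K ≫ pathSpaceEval _ 1 = TopCat.ofHom (ContinuousMap.const _ (ι 0 b)) := by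
    refine hlim.hom_ext fun n => ?_
    change ι n ≫ K ≫ pathSpaceEval _ 1 = ι n ≫ _
    rw [reassoc_of% (hK n)]
    ext x
    exact (congrArg (ι (n + 1)) ((H n).map_one x)).trans (hbase (n + 1))
  rw [contractible_iff_id_nullhomotopic]
  refine ⟨ι 0 b, ⟨⟨⟨fun x => K x.2 x.1, ?_⟩, fun x => ?_, fun x => ?_⟩⟩⟩
  · exact ContinuousEval.continuous_eval.comp
      ((K.hom.continuous.comp continuous_snd).prodMk continuous_fst)
  · exact congrArg (fun f => f.hom x) hK₀
  · exact congrArg (fun f => f.hom x) hK₁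

end ProjectiveCWComplex

end

/-! ## Killing all homotopy of the Cayley graph -/

section

variable {M : Type u} [Monoid M]

theorem FreeAct.isProjectiveAct (M J : Type u) [Monoid M] : IsProjectiveAct M (FreeAct M J) := by
  intro X _ f hf
  choose s hs using fun j : J => hf ((1, j) : FreeAct M J)
  refine ⟨⟨fun x => x.1 • s x.2, fun m x => mul_smul m x.1 (s x.2)⟩, fun x => ?_⟩
  refine (map_smul f x.1 (s x.2)).trans ?_
  rw [hs]
  exact Prod.ext (mul_one _) rfl

theorem FreeAct.isFinitelyGeneratedAct (M J : Type u) [Monoid M] [Finite J] :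
    IsFinitelyGeneratedAct M (FreeAct M J) := by
  let e : J → FreeAct M J := fun j => (1, j)
  exact ⟨(Set.finite_range e).toFinset, fun x => ⟨e x.2,
    (Set.finite_range e).mem_toFinset.mpr ⟨x.2, rfl⟩, x.1, Prod.ext (mul_one _) rfl⟩⟩

/-- The equivariant map `M × J × K → Y` extending a family of maps `K → Y` indexed by `J`. -/
def freeMap {K : TopCat.{u}} {Y : Action TopCat.{u} M} {J : Type u} (f : J → (K ⟶ Y.V)) :
    prodTrivial M (FreeAct M J) K ⟶ Y where
  hom := TopCat.ofHom (X := FreeAct M J × K)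
    ⟨fun x => TopCat.Hom.hom (Y.ρ x.1.1) (f x.1.2 x.2), continuous_prod_of_discrete_left.mpr
      fun p => (TopCat.Hom.hom (Y.ρ p.1)).continuous.comp (f p.2).hom.continuous⟩
  comm m := by
    ext x
    exact congrArg (fun g => TopCat.Hom.hom g (f x.1.2 x.2)) (map_mul Y.ρ m x.1.1)

/-- A family of attaching maps for free `(n + 1)`-cells on an `M`-space. -/
structure AttachingFamily (n : ℕ) (Y : Action TopCat.{u} M) where
  /-- the index set of the cells -/
  index : Type u
  /-- the attaching maps -/
  map : index → (TopCat.diskBoundary.{u} (n + 1) ⟶ Y.V)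

/-- The `M`-space obtained by attaching free cells. -/
noncomputable def AttachingFamily.space {n : ℕ} {Y : Action TopCat.{u} M}
    (D : AttachingFamily n Y) : Action TopCat.{u} M :=
  pushout (freeMap D.map)
    (prodTrivialMap M (FreeAct M D.index) (TopCat.diskBoundaryInclusion.{u} (n + 1)))

/-- The family of all attaching maps. -/
def AttachingFamily.all (n : ℕ) (Y : Action TopCat.{u} M) : AttachingFamily n Y where
  index := TopCat.diskBoundary.{u} (n + 1) ⟶ Y.V
  map f := f

/-- The skeleta obtained from an `M`-space `Y` by attaching a given family of free 1-cells, and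
then free cells along all possible maps, together with the attaching maps of the next cells. -/
noncomputable def killingStage {Y : Action TopCat.{u} M} (D : AttachingFamily 0 Y) :
    ∀ n, (Z : Action TopCat.{u} M) × AttachingFamily n Z
  | 0 => ⟨Y, D⟩
  | n + 1 => ⟨(killingStage D n).2.space, .all (n + 1) _⟩

/-- The index sets of the free cells. -/
def cellIndex {Y : Action TopCat.{u} M} (D : AttachingFamily 0 Y) (J : Type u) : ℕ → Type u
  | 0 => J
  | n + 1 => (killingStage D n).2.index

/-- The complex obtained from the discrete free `M`-set on `J` by attaching a given family of free
1-cells, and then free cells along all possible maps. -/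
noncomputable def killingComplex (J : Type u)
    (D : AttachingFamily 0 (discreteSpace M (FreeAct M J))) : ProjectiveCWComplex M where
  skeleton n := (killingStage D n).1
  incl n := pushout.inl (freeMap (killingStage D n).2.map) _
  cells n := FreeAct M (cellIndex D J n)
  projective _ := FreeAct.isProjectiveAct M _
  zeroIso := Iso.refl _
  attach n := freeMap (killingStage D n).2.map
  char n := pushout.inr (freeMap (killingStage D n).2.map) _
  isPushout _ := IsPushout.of_hasPushout _ _
  cocone := colimit.cocone _
  isColimit := colimit.isColimit _

theorem killingComplex_exists_extension {J : Type u}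
    (D : AttachingFamily 0 (discreteSpace M (FreeAct M J))) (n : ℕ)
    (f : TopCat.diskBoundary.{u} (n + 2) ⟶ ((killingComplex J D).skeleton (n + 1)).V) :
    ∃ g : TopCat.disk.{u} (n + 2) ⟶ ((killingComplex J D).skeleton (n + 2)).V,
      TopCat.diskBoundaryInclusion (n + 2) ≫ g = f ≫ ((killingComplex J D).incl (n + 1)).hom := by
  -- Every map of the sphere indexes a cell, so `f` is filled by the cell attached along `f` itself.
  let p : (killingComplex J D).cells (n + 2) := (1, f)
  refine ⟨TopCat.ofHom ⟨fun x => ((killingComplex J D).char (n + 1)).hom (p, x),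
    ((killingComplex J D).char (n + 1)).hom.hom.continuous.comp (.prodMk_right p)⟩, ?_⟩
  ext s
  have h₁ : ((killingComplex J D).attach (n + 1)).hom (p, s) = f s :=
    congrArg (fun g => TopCat.Hom.hom g (f s)) (map_one ((killingComplex J D).skeleton (n + 1)).ρ)
  have h₂ := congrArg (fun g => g.hom (p, s))
    ((killingComplex J D).isPushout_forget (n + 1)).w
  exact h₂.symm.trans (congrArg ((killingComplex J D).incl (n + 1)).hom h₁)

/-- The closed 1-cell is the image of a path-connected disk. -/
theorem joined_incl_zero (X : ProjectiveCWComplex M) (p : X.cells 1)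
    (s t : TopCat.diskBoundary.{u} 1) :
    Joined ((X.incl 0).hom ((X.attach 0).hom (p, s)))
      ((X.incl 0).hom ((X.attach 0).hom (p, t))) := by
  have hD : PathConnectedSpace (TopCat.disk.{u} 1) := by
    have : PathConnectedSpace (Metric.closedBall (0 : EuclideanSpace ℝ (Fin 1)) 1) :=
      isPathConnected_iff_pathConnectedSpace.mp
        ((convex_closedBall _ _).isPathConnected ⟨0, by simp⟩)
    exact Homeomorph.ulift.symm.surjective.pathConnectedSpace Homeomorph.ulift.symm.continuous
  have hw (s) : (X.incl 0).hom ((X.attach 0).hom (p, s)) =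
      (X.char 0).hom (p, TopCat.diskBoundaryInclusion 1 s) :=
    congrArg (fun f => f.hom (p, s)) (X.isPushout_forget 0).w
  rw [hw, hw]
  obtain ⟨γ⟩ := hD.joined (TopCat.diskBoundaryInclusion 1 s) (TopCat.diskBoundaryInclusion 1 t)
  exact ⟨γ.map (f := fun x => (X.char 0).hom (p, x))
    ((X.char 0).hom.hom.continuous.comp (.prodMk_right p))⟩

/-- The family of 1-cells of the Cayley graph `Γ(M, A)`. -/
noncomputable def cayleyFamily (A : Set M) :
    AttachingFamily 0 (discreteSpace M (FreeAct M PUnit.{u + 1})) where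
  index := A
  map a := TopCat.ofHom (Y := FreeAct M PUnit.{u + 1})
    -- On `S⁰ = {-1, 1}`, the point `-1` goes to `1 : M` and the point `1` to `a`; the translate by
    -- `m` thus joins `m` to `m * a`.
    ⟨fun t => open Classical in (if 0 < t.down.1 0 then (a : M) else 1, PUnit.unit), by
      have : T2Space (TopCat.diskBoundary.{u} 1) := Homeomorph.ulift.symm.t2Space
      exact continuous_of_discreteTopology (α := TopCat.diskBoundary.{u} 1)⟩

theorem cayleyFamily_joined (A : Set M) (m : M) {a : M} (ha : a ∈ A) :
    Joined (((killingComplex _ (cayleyFamily A)).incl 0).hom ((m, PUnit.unit) : FreeAct M PUnit))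
      (((killingComplex _ (cayleyFamily A)).incl 0).hom
        ((m * a, PUnit.unit) : FreeAct M PUnit)) := by
  let s : TopCat.diskBoundary.{u} 1 := ⟨EuclideanSpace.single 0 (-1), by simp⟩
  let t : TopCat.diskBoundary.{u} 1 := ⟨EuclideanSpace.single 0 1, by simp⟩
  let p : (killingComplex _ (cayleyFamily A)).cells 1 := (m, ⟨a, ha⟩)
  have hs : ((killingComplex _ (cayleyFamily A)).attach 0).hom (p, s) =
      ((m, PUnit.unit) : FreeAct M PUnit) := by
    refine Prod.ext ?_ rfl
    change m * (if 0 < s.down.1 0 then a else 1) = m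
    simp [s]
  have ht : ((killingComplex _ (cayleyFamily A)).attach 0).hom (p, t) =
      ((m * a, PUnit.unit) : FreeAct M PUnit) := by
    refine Prod.ext ?_ rfl
    change m * (if 0 < t.down.1 0 then a else 1) = m * a
    simp [t]
  have := joined_incl_zero _ p s t
  rwa [hs, ht] at this

theorem isLeftF_one_of_connected_cayleyDigraph {A : Set M} (hA : A.Finite)
    (h : IsConnectedUndirected (CayleyDigraph A)) : IsLeftF 1 M := by
  rw [isConnectedUndirected_cayleyDigraph_iff] at h
  let X := killingComplex _ (cayleyFamily A)
  have hjoin : ∀ x y, Relation.EqvGen (CayleyAdj A) x y →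
      Joined ((X.incl 0).hom ((x, PUnit.unit) : FreeAct M PUnit))
        ((X.incl 0).hom ((y, PUnit.unit) : FreeAct M PUnit)) := by
    intro x y hxy
    induction hxy with
    | rel x y h =>
      obtain ⟨a, ha, rfl⟩ := h
      exact cayleyFamily_joined A x ha
    | refl x => exact .refl _
    | symm x y _ ih => exact ih.symm
    | trans x y z _ _ ih₁ ih₂ => exact ih₁.trans ih₂
  refine ⟨X, ProjectiveCWComplex.contractibleSpace_of_exists_extension
    ((1, PUnit.unit) : FreeAct M PUnit) (fun x => hjoin _ _ (h x.1).symm)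
    (killingComplex_exists_extension _), fun k hk => ?_⟩
  interval_cases k
  · exact FreeAct.isFinitelyGeneratedAct M PUnit
  · have : Finite A := hA
    exact FreeAct.isFinitelyGeneratedAct M A

end

end MonoidFiniteness

theorem theoremt (M : Type u) [Monoid M] :
    List.TFAE
      [MonoidFiniteness.IsLeftF 1 M,
       MonoidFiniteness.IsLeftFP 1 M,
       ∃ A : Set M, A.Finite ∧
         MonoidFiniteness.IsConnectedUndirected (MonoidFiniteness.CayleyDigraph A)] ∧
    (Monoid.FG M → MonoidFiniteness.IsLeftF 1 M) := by
  constructor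
  · tfae_have 1 → 3 := fun h => h.exists_finite_connected_cayleyDigraph
    tfae_have 3 → 1 := fun ⟨_, hA, h⟩ =>
      MonoidFiniteness.isLeftF_one_of_connected_cayleyDigraph hA h
    tfae_have 2 ↔ 3 := MonoidFiniteness.isLeftFP_one_iff
    tfae_finish
  · rintro ⟨S, hS⟩
    exact MonoidFiniteness.isLeftF_one_of_connected_cayleyDigraph S.finite_toSet
      (MonoidFiniteness.isConnectedUndirected_cayleyDigraph_of_closure_eq_top hS)
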